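/- Let $n$ be a positive integer and let $\Theta=(V,E)$ be a simple oriented graph on $V=[n]=\{1,\dots,n\}$, that is, a finite oriented graph with no multiple arrows and no oriented cycles of length one or two. Write $i\to j$ if $(i,j)\in E$, and call distinct $i,j\in V$ not connected if neither $i\to j$ nor $j\to i$. The Hecke--Kiselman monoid $\mathrm{HK}_\Theta$ is the monoid generated by idempotents $x_1,\dots,x_n$ subject to the relations $x_ix_j=x_jx_i$ if $i$ and $j$ are not connected, and $x_ix_jx_i=x_jx_ix_j=x_ix_j$ if $i\to j$. For $x\in\mathrm{HK}_\Theta$ the content $c(x)\subseteq[n]$ is the set of those $i$ for which $x_i$ occurs in a word representing $x$ (it does not depend on the word). Let $A_\Theta$ be the set of all $X\subseteq V$ such that the full subgraph of $\Theta$ on $X$ contains no oriented cycle. For $X,Y\in A_\Theta$ let $p(X,Y)$ be the condition that there do not exist $b\in Y\setminus X$, $a\in X\setminus Y$, $r\ge 0$ and $i_1,\dots,i_r\in X\cap Y$ with $b\to i_1\to\dots\to i_r\to a$ (for $r=0$ this means $b\to a$). Let $S_n$ be the set of all sequences $\mathbf X=(X_1,\dots,X_n)$ of subsets of $[n]$;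 it is a monoid under the operation $\mathbf X\ast\mathbf Y=\mathbf Z$ with $Z_i=\bigcup_{j\in Y_i}X_j$, with unit $(\{1\},\dots,\{n\})$. Let $S_n(\Theta,p)\subseteq S_n$ be the set of $(\Theta,p)$-pure sequences, i.e. those $\mathbf X$ such that for all $i,j\in[n]$: (i) $X_i\in A_\Theta$; (ii) $p(X_i,X_j)$ and $p(X_j,X_i)$ hold if $i$ and $j$ are not connected; (iii) $p(X_i,X_j)$ holds if $i\to j$. Let $B_n$ be the monoid of $n\times n$ Boolean matrices with $(A\cdot B)_{i,j}=\bigvee_{k=1}^n(A_{i,k}\wedge B_{k,j})$, and let $\Psi:S_n\to B_n$ be given by $\Psi(\mathbf X)_{x,i}=1$ if $x\in X_i$ and $\Psi(\mathbf X)_{x,i}=0$ otherwise, so that the $i$-th column of $\Psi(\mathbf X)$ is the characteristic vector of $X_i$. Then $S_n(\Theta,p)$ is a submonoid of $(S_n,\ast)$; the map $\varphi\mapsto(c(\varphi(x_1)),\dots,c(\varphi(x_n)))$ is an isomorphism of monoids from the endomorphism monoid $\mathrm{End}(\mathrm{HK}_\Theta)$ (under composition, $(\psi\varphi)(x)=\psi(\varphi(x))$)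 to $(S_n(\Theta,p),\ast)$; the set $\Psi(S_n(\Theta,p))$ is a submonoid of $(B_n,\cdot)$; and $\Psi$ restricts to an isomorphism of monoids from $(S_n(\Theta,p),\ast)$ to $(\Psi(S_n(\Theta,p)),\cdot)$. In particular, $$\mathrm{End}(\mathrm{HK}_\Theta)\cong(S_n(\Theta,p),\ast)\cong(\Psi(S_n(\Theta,p)),\cdot).$$ -/

import Mathlib

/-! Hecke–Kiselman monoids of simple oriented graphs, pure sequences, Boolean matrices. -/

namespace HeckeKiselman

variable {n : ℕ}

/-- A simple oriented graph on `{1, …, n}` (here `Fin n`): a directed graph without multiple arrows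
(automatic for `Digraph`) and without oriented cycles of length one or two. -/
structure IsSimpleOriented (Θ : Digraph (Fin n)) : Prop where
  no_loop : ∀ i, ¬ Θ.Adj i i
  no_two_cycle : ∀ i j, Θ.Adj i j → ¬ Θ.Adj j i

/-- `i` and `j` are distinct and there is no arrow between them in either direction. -/
def Disconnected (Θ : Digraph (Fin n)) (i j : Fin n) : Prop :=
  i ≠ j ∧ ¬ Θ.Adj i j ∧ ¬ Θ.Adj j i

/-- The letter `x_i` of the free monoid. -/
abbrev letter (i : Fin n) : FreeMonoid (Fin n) := FreeMonoid.of i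

/-- The defining relations of the Hecke–Kiselman monoid. -/
inductive Rel (Θ : Digraph (Fin n)) : FreeMonoid (Fin n) → FreeMonoid (Fin n) → Prop
  | idem (i : Fin n) : Rel Θ (letter i * letter i) (letter i)
  | comm (i j : Fin n) (h : Disconnected Θ i j) :
      Rel Θ (letter i * letter j) (letter j * letter i)
  | braid_left (i j : Fin n) (h : Θ.Adj i j) :
      Rel Θ (letter i * letter j * letter i) (letter i * letter j)
  | braid_right (i j : Fin n) (h : Θ.Adj i j) :
      Rel Θ (letter j * letter i * letter j) (letter i * letter j)

/-- The Hecke–Kiselman monoid `HK_Θ`. -/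
abbrev HK (Θ : Digraph (Fin n)) : Type := PresentedMonoid (Rel Θ)

/-- The generator `x_i` of `HK_Θ`. -/
def gen (Θ : Digraph (Fin n)) (i : Fin n) : HK Θ := PresentedMonoid.of (Rel Θ) i

/-- The set of indices of the letters that occur in a word. -/
def wordContent (w : FreeMonoid (Fin n)) : Finset (Fin n) := (FreeMonoid.toList w).toFinset

theorem wordContent_mul (v w : FreeMonoid (Fin n)) :
    wordContent (v * w) = wordContent v ∪ wordContent w := by
  simp [wordContent, FreeMonoid.toList_mul]

theorem wordContent_letter (i : Fin n) : wordContent (letter i) = {i} := by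
  simp [wordContent, FreeMonoid.toList_of]

/-- Having the same content is a congruence on the free monoid. -/
def contentCon (n : ℕ) : Con (FreeMonoid (Fin n)) where
  r v w := wordContent v = wordContent w
  iseqv := ⟨fun _ => rfl, fun h => h.symm, fun h h' => h.trans h'⟩
  mul' := by
    intro a b c d h h'
    rw [wordContent_mul, wordContent_mul, show wordContent a = wordContent b from h,
      show wordContent c = wordContent d from h']

theorem conGen_rel_le_contentCon (Θ : Digraph (Fin n)) : conGen (Rel Θ) ≤ contentCon n := by
  refine Con.conGen_le.2 ?_
  intro v w h
  change wordContent v = wordContent w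
  cases h <;> simp only [wordContent_mul, wordContent_letter] <;> ext k <;>
    simp only [Finset.mem_union, Finset.mem_singleton] <;> tauto

/-- The content `c(x)` of `x ∈ HK_Θ`: the content of any word that represents `x`. -/
def content {Θ : Digraph (Fin n)} (x : HK Θ) : Finset (Fin n) :=
  Con.liftOn (c := conGen (Rel Θ)) x wordContent
    (fun _ _ h => conGen_rel_le_contentCon Θ h)

theorem content_mk (Θ : Digraph (Fin n)) (w : FreeMonoid (Fin n)) :
    content (PresentedMonoid.mk (Rel Θ) w) = wordContent w := rfl

/-- The set `A_Θ` of all `X ⊆ V` such that the full subgraph `Θ[X]` contains no oriented cycle,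
that is, no vertex of `Θ[X]` is joined to itself by a directed walk of positive length in `Θ[X]`. -/
def acyclicSets (Θ : Digraph (Fin n)) : Set (Finset (Fin n)) :=
  {X | ∀ v, ¬ Relation.TransGen (fun i j => i ∈ X ∧ j ∈ X ∧ Θ.Adj i j) v v}

/-- The predicate `p(X, Y)`: there are no `b ∈ Y \ X`, `a ∈ X \ Y`, `r ≥ 0` and
`i_1, …, i_r ∈ X ∩ Y` with `b → i_1 → ⋯ → i_r → a`. -/
def P (Θ : Digraph (Fin n)) (X Y : Finset (Fin n)) : Prop :=
  ¬ ∃ b ∈ Y \ X, ∃ a ∈ X \ Y, ∃ l : List (Fin n),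
    (∀ i ∈ l, i ∈ X ∩ Y) ∧ List.IsChain Θ.Adj (b :: (l ++ [a]))

/-- `S_n`: sequences of `n` subsets of `{1, …, n}`. -/
@[ext] structure SetSeq (n : ℕ) where
  sets : Fin n → Finset (Fin n)

/-- `(X ∗ Y)_i = ⋃_{j ∈ Y_i} X_j`. -/
instance : Mul (SetSeq n) := ⟨fun X Y => ⟨fun i => (Y.sets i).biUnion X.sets⟩⟩

/-- The unit `({1}, {2}, …, {n})`. -/
instance : One (SetSeq n) := ⟨⟨fun i => {i}⟩⟩

theorem SetSeq.mul_sets (X Y : SetSeq n) (i : Fin n) :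
    (X * Y).sets i = (Y.sets i).biUnion X.sets := rfl

theorem SetSeq.one_sets (i : Fin n) : (1 : SetSeq n).sets i = {i} := rfl

instance : Monoid (SetSeq n) where
  mul_assoc X Y Z := by
    ext i k
    simp only [SetSeq.mul_sets, Finset.mem_biUnion]
    grind
  one_mul X := by
    ext i k
    simp [SetSeq.mul_sets, SetSeq.one_sets]
  mul_one X := by
    ext i k
    simp [SetSeq.mul_sets, SetSeq.one_sets]

/-- `(Θ, p)`-pure sequences. -/
structure IsPure (Θ : Digraph (Fin n)) (X : SetSeq n) : Prop where
  acyclic : ∀ i, X.sets i ∈ acyclicSets Θ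
  disconnected : ∀ i j, Disconnected Θ i j →
    P Θ (X.sets i) (X.sets j) ∧ P Θ (X.sets j) (X.sets i)
  arrow : ∀ i j, Θ.Adj i j → P Θ (X.sets i) (X.sets j)

/-- The set `S_n(Θ, p)`. -/
def pureSeqs (Θ : Digraph (Fin n)) : Set (SetSeq n) := {X | IsPure Θ X}

/-- `B_n`: Boolean `n × n` matrices. This is not `Matrix (Fin n) (Fin n) Bool`, whose product in
Mathlib would use exclusive or as addition. -/
@[ext] structure BoolMatrix (n : ℕ) where
  entry : Fin n → Fin n → Bool

/-- `(A · B)_{i,j} = ⋁_k (A_{i,k} ∧ B_{k,j})`. -/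
instance : Mul (BoolMatrix n) :=
  ⟨fun A B => ⟨fun i j => decide (∃ k, (A.entry i k && B.entry k j) = true)⟩⟩

/-- The identity matrix. -/
instance : One (BoolMatrix n) := ⟨⟨fun i j => decide (i = j)⟩⟩

theorem BoolMatrix.mul_entry (A B : BoolMatrix n) (i j : Fin n) :
    (A * B).entry i j = true ↔ ∃ k, A.entry i k = true ∧ B.entry k j = true := by
  change decide _ = true ↔ _
  simp

theorem BoolMatrix.one_entry (i j : Fin n) :
    (1 : BoolMatrix n).entry i j = true ↔ i = j := decide_eq_true_iff

instance : Monoid (BoolMatrix n) where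
  mul_assoc A B C := by
    ext i j
    rw [Bool.eq_iff_iff]
    simp only [BoolMatrix.mul_entry]
    grind
  one_mul A := by
    ext i j
    rw [Bool.eq_iff_iff]
    simp [BoolMatrix.mul_entry, BoolMatrix.one_entry]
  mul_one A := by
    ext i j
    rw [Bool.eq_iff_iff]
    simp [BoolMatrix.mul_entry, BoolMatrix.one_entry]

/-- The map `Ψ : S_n → B_n`: the `i`-th column of `Ψ(X)` is the characteristic vector of `X_i`. -/
def Psi (X : SetSeq n) : BoolMatrix n := ⟨fun x i => decide (x ∈ X.sets i)⟩

end HeckeKiselman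

/-!
An endomorphism of `HK_Θ` is given by the idempotents `φ(x_i)`, so the theorem rests on a
description of idempotents and of the relations between them.

For acyclic `X`, the submonoid generated by the `x_i` with `i ∈ X` has a zero `z_X`, the product of
these letters in an order compatible with the arrows (`exists_isZeroOn`). Conversely, every
idempotent `e` is the zero for its content (`isZeroOn_content_of_mul_self`). Its content is acyclic
because `HK_Θ` acts on `ℕ^n` by the updates `v i := sup_{j → i} (v j + 1)`; an idempotent, having
acted on the zero vector, leaves a vector fixed by each of its letters, and such a vector strictly
increases along the arrows in the content. Working from the sinks of the content upwards, one then
sees that `e` absorbs all of its letters. Hence idempotents correspond to acyclic sets.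

For acyclic `X` and `Y`, the relations `xyx = yxy = xy` between `x = z_X` and `y = z_Y` are
equivalent to `p(X, Y)`. If `p(X, Y)` holds, let `R ⊆ X ∩ Y` be the part reached from `Y \ X` by
arrows inside `X`. Then `x = z_{X \ R} z_R`, `z_R` is absorbed by `y`, and the letters of `Y \ X`
have no arrows into `X \ R`, so that `xy` is the zero for `X ∪ Y` (`IsZeroOn.mul_of_P`).
Conversely, a walk forbidden by `p(X, Y)` is detected by the action of `HK_Θ` on subsets of `V` by
the updates "`i` belongs to the set if some `j → i` does" (`P_of_mul_mul_eq`). The commutation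
relation amounts to `p(X, Y)` and `p(Y, X)` together.

Therefore `φ ↦ (c(φ(x_i)))_i`, which is multiplicative, is injective with image the set of pure
sequences; in particular this set is a submonoid.
-/

namespace HeckeKiselman

variable {n : ℕ} {Θ : Digraph (Fin n)}

/-! ### Content and words -/

theorem content_one : content (1 : HK Θ) = ∅ := rfl

theorem content_gen (i : Fin n) : content (gen Θ i) = {i} := wordContent_letter i

theorem content_mul (x y : HK Θ) : content (x * y) = content x ∪ content y := by
  induction x using PresentedMonoid.inductionOn with | _ v
  induction y using PresentedMonoid.inductionOn with | _ w
  rw [← map_mul, content_mk, content_mk, content_mk, wordContent_mul]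

/-- Left-to-right induction on a word representing an element of `HK_Θ`. -/
theorem gen_mul_induction {p : HK Θ → Prop} (one : p 1)
    (gen_mul : ∀ a m, p m → p (gen Θ a * m)) (m : HK Θ) : p m := by
  induction m using PresentedMonoid.inductionOn with | _ w
  induction w using FreeMonoid.inductionOn' with
  | one => exact one
  | of_mul a w ih => rw [map_mul]; exact gen_mul a _ ih

theorem mul_eq_right_of_content_subset {X : Finset (Fin n)} {z m : HK Θ}
    (hz : ∀ i ∈ X, gen Θ i * z = z) (hm : content m ⊆ X) : m * z = z := by
  induction m using gen_mul_induction with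
  | one => exact one_mul z
  | gen_mul a m ih =>
    rw [content_mul, content_gen, Finset.union_subset_iff, Finset.singleton_subset_iff] at hm
    rw [mul_assoc, ih hm.2, hz a hm.1]

theorem mul_eq_left_of_content_subset {X : Finset (Fin n)} {z m : HK Θ}
    (hz : ∀ i ∈ X, z * gen Θ i = z) (hm : content m ⊆ X) : z * m = z := by
  induction m using gen_mul_induction with
  | one => exact mul_one z
  | gen_mul a m ih =>
    rw [content_mul, content_gen, Finset.union_subset_iff, Finset.singleton_subset_iff] at hm
    rw [← mul_assoc, hz a hm.1, ih hm.2]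

/-! ### Absorption of letters -/

theorem gen_mul_self (i : Fin n) : gen Θ i * gen Θ i = gen Θ i :=
  PresentedMonoid.mk_eq_mk_of_rel (Rel.idem i)

theorem gen_comm {i j : Fin n} (h : Disconnected Θ i j) :
    gen Θ i * gen Θ j = gen Θ j * gen Θ i :=
  PresentedMonoid.mk_eq_mk_of_rel (Rel.comm i j h)

theorem gen_braid_left {i j : Fin n} (h : Θ.Adj i j) :
    gen Θ i * gen Θ j * gen Θ i = gen Θ i * gen Θ j :=
  PresentedMonoid.mk_eq_mk_of_rel (Rel.braid_left i j h)

theorem gen_braid_right {i j : Fin n} (h : Θ.Adj i j) :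
    gen Θ j * gen Θ i * gen Θ j = gen Θ i * gen Θ j :=
  PresentedMonoid.mk_eq_mk_of_rel (Rel.braid_right i j h)

theorem gen_mul_gen_mul_gen_of_not_adj {t a : Fin n} (h : ¬ Θ.Adj t a) :
    gen Θ t * gen Θ a * gen Θ t = gen Θ a * gen Θ t := by
  by_cases hta : t = a
  · subst hta; rw [gen_mul_self, gen_mul_self]
  by_cases hat : Θ.Adj a t
  · exact gen_braid_right hat
  · rw [gen_comm ⟨hta, h, hat⟩, mul_assoc, gen_mul_self]

theorem gen_mul_gen_mul_gen_of_not_adj' {t a : Fin n} (h : ¬ Θ.Adj a t) :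
    gen Θ t * gen Θ a * gen Θ t = gen Θ t * gen Θ a := by
  by_cases hta : t = a
  · subst hta; rw [gen_mul_self, gen_mul_self]
  by_cases hat : Θ.Adj t a
  · exact gen_braid_left hat
  · rw [mul_assoc, gen_comm (i := a) ⟨Ne.symm hta, h, hat⟩, ← mul_assoc, gen_mul_self]

/-- A letter without arrows into the rest of a word that contains it is absorbed on the left. -/
theorem gen_mul_eq_of_mem_content {t : Fin n} {m : HK Θ} (ht : t ∈ content m)
    (h : ∀ j ∈ content m, ¬ Θ.Adj t j) : gen Θ t * m = m := by
  induction m using gen_mul_induction with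
  | one => simp [content_one] at ht
  | gen_mul a m ih =>
    simp only [content_mul, content_gen, Finset.mem_union, Finset.mem_singleton] at ht h
    by_cases htm : t ∈ content m
    · have ih := ih htm fun j hj => h j (Or.inr hj)
      calc gen Θ t * (gen Θ a * m) = gen Θ t * gen Θ a * gen Θ t * m := by
            rw [mul_assoc _ (gen Θ t) m, ih, mul_assoc]
        _ = gen Θ a * m := by
            rw [gen_mul_gen_mul_gen_of_not_adj (h a (Or.inl rfl)), mul_assoc, ih]
    · obtain rfl := ht.resolve_right htm
      rw [← mul_assoc, gen_mul_self]

theorem gen_mul_mul_gen_of_not_adj {t : Fin n} {m : HK Θ}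
    (h : ∀ j ∈ content m, ¬ Θ.Adj j t) : gen Θ t * m * gen Θ t = gen Θ t * m := by
  induction m using gen_mul_induction with
  | one => rw [mul_one, gen_mul_self]
  | gen_mul a m ih =>
    simp only [content_mul, content_gen, Finset.mem_union, Finset.mem_singleton] at h
    have ih := ih fun j hj => h j (Or.inr hj)
    have ha := gen_mul_gen_mul_gen_of_not_adj' (h a (Or.inl rfl))
    calc gen Θ t * (gen Θ a * m) * gen Θ t
        = gen Θ t * gen Θ a * (gen Θ t * m * gen Θ t) := by
          rw [← mul_assoc, ← ha]; simp only [mul_assoc]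
          rw [← mul_assoc (gen Θ t) (gen Θ t), gen_mul_self]
      _ = gen Θ t * (gen Θ a * m) := by
          rw [ih, ← mul_assoc, ha, mul_assoc]

/-- A letter without arrows from the rest of a word that contains it is absorbed on the right. -/
theorem mul_gen_eq_of_mem_content {t : Fin n} {m : HK Θ} (ht : t ∈ content m)
    (h : ∀ j ∈ content m, ¬ Θ.Adj j t) : m * gen Θ t = m := by
  induction m using gen_mul_induction with
  | one => simp [content_one] at ht
  | gen_mul a m ih =>
    simp only [content_mul, content_gen, Finset.mem_union, Finset.mem_singleton] at ht h
    by_cases htm : t ∈ content m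
    · rw [mul_assoc, ih htm fun j hj => h j (Or.inr hj)]
    · obtain rfl := ht.resolve_right htm
      exact gen_mul_mul_gen_of_not_adj fun j hj => h j (Or.inr hj)

/-! ### Zeros of parabolic submonoids -/

/-- `z` has content `X` and is the zero of the submonoid generated by the `x_i` with `i ∈ X`. -/
structure IsZeroOn (X : Finset (Fin n)) (z : HK Θ) : Prop where
  content_eq : content z = X
  gen_mul : ∀ i ∈ X, gen Θ i * z = z
  mul_gen : ∀ i ∈ X, z * gen Θ i = z

theorem IsZeroOn.mul_self {X : Finset (Fin n)} {z : HK Θ} (hz : IsZeroOn X z) : z * z = z :=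
  mul_eq_left_of_content_subset hz.mul_gen hz.content_eq.subset

theorem IsZeroOn.unique {X : Finset (Fin n)} {z w : HK Θ} (hz : IsZeroOn X z)
    (hw : IsZeroOn X w) : z = w :=
  (mul_eq_left_of_content_subset hz.mul_gen hw.content_eq.subset).symm.trans
    (mul_eq_right_of_content_subset hw.gen_mul hz.content_eq.subset)

theorem isZeroOn_singleton (s : Fin n) : IsZeroOn {s} (gen Θ s) where
  content_eq := content_gen s
  gen_mul i hi := by rw [Finset.mem_singleton.1 hi, gen_mul_self]
  mul_gen i hi := by rw [Finset.mem_singleton.1 hi, gen_mul_self]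

/-- Zeros multiply when no arrow leads from the second set to the first: a letter of `W` passes `U`
from the left, and a letter of `U` passes `W` from the right. -/
theorem IsZeroOn.mul (hΘ : IsSimpleOriented Θ) {U W : Finset (Fin n)} {u w : HK Θ}
    (hu : IsZeroOn U u) (hw : IsZeroOn W w) (h : ∀ i ∈ W, ∀ j ∈ U, ¬ Θ.Adj i j) :
    IsZeroOn (U ∪ W) (u * w) where
  content_eq := by rw [content_mul, hu.content_eq, hw.content_eq]
  gen_mul i hi := by
    by_cases hiU : i ∈ U
    · rw [← mul_assoc, hu.gen_mul i hiU]
    · have hiW : i ∈ W := (Finset.mem_union.1 hi).resolve_left hiU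
      have key : gen Θ i * (u * gen Θ i) = u * gen Θ i := by
        apply gen_mul_eq_of_mem_content <;>
          simp only [content_mul, content_gen, Finset.mem_union, Finset.mem_singleton, or_true,
            hu.content_eq]
        rintro j (hj | rfl)
        · exact h i hiW j hj
        · exact hΘ.no_loop j
      rw [← hw.gen_mul i hiW, ← mul_assoc u, ← mul_assoc, key]
  mul_gen i hi := by
    by_cases hiW : i ∈ W
    · rw [mul_assoc, hw.mul_gen i hiW]
    · have hiU : i ∈ U := (Finset.mem_union.1 hi).resolve_right hiW
      have key : gen Θ i * w * gen Θ i = gen Θ i * w :=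
        gen_mul_mul_gen_of_not_adj fun j hj => h j (hw.content_eq ▸ hj) i hiU
      rw [← hu.mul_gen i hiU, mul_assoc u, mul_assoc u, key]

theorem acyclicSets_mono {X Y : Finset (Fin n)} (h : X ⊆ Y) (hY : Y ∈ acyclicSets Θ) :
    X ∈ acyclicSets Θ := fun v hv =>
  hY v (Relation.TransGen.mono (fun _ _ hij => ⟨h hij.1, h hij.2.1, hij.2.2⟩) v v hv)

theorem wellFounded_transGen_of_acyclic {X : Finset (Fin n)} (hX : X ∈ acyclicSets Θ) :
    WellFounded (Relation.TransGen fun i j => i ∈ X ∧ j ∈ X ∧ Θ.Adj i j) :=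
  haveI : Std.Irrefl (Relation.TransGen fun i j => i ∈ X ∧ j ∈ X ∧ Θ.Adj i j) := ⟨hX⟩
  Finite.wellFounded_of_trans_of_irrefl _

/-- The zero of an acyclic `X` is the product of its letters in an order compatible with the
arrows: a source of `X` goes first. -/
theorem exists_isZeroOn (hΘ : IsSimpleOriented Θ) {X : Finset (Fin n)}
    (hX : X ∈ acyclicSets Θ) : ∃ z : HK Θ, IsZeroOn X z := by
  induction X using Finset.strongInduction with
  | H X ih =>
    obtain rfl | hne := X.eq_empty_or_nonempty
    · exact ⟨1, content_one, by simp, by simp⟩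
    obtain ⟨s, hs, hmin⟩ := (wellFounded_transGen_of_acyclic hX).has_min (X : Set (Fin n)) hne
    obtain ⟨z, hz⟩ := ih (X.erase s) (Finset.erase_ssubset hs)
      (acyclicSets_mono (Finset.erase_subset s X) hX)
    refine ⟨gen Θ s * z, ?_⟩
    have := (isZeroOn_singleton s).mul hΘ hz fun i hi j hj hij => by
      rw [Finset.mem_singleton.1 hj] at hij
      exact hmin i (Finset.mem_of_mem_erase hi) (.single ⟨Finset.mem_of_mem_erase hi, hs, hij⟩)
    rwa [← Finset.insert_eq, Finset.insert_erase hs] at this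

/-! ### Actions by updating one coordinate -/

/-- If the new value `F v i` of the `i`-th coordinate depends only on the coordinates of `v` at
the in-neighbours of `i`, then `HK_Θ` acts on tuples from the right, `x_i` replacing `v i` by
`F v i`. The opposite monoid expresses that the first letter of a word acts first. -/
def updateAction {α : Type*} (hΘ : IsSimpleOriented Θ) (F : (Fin n → α) → Fin n → α)
    (hF : ∀ v w i, (∀ j, Θ.Adj j i → v j = w j) → F v i = F w i) :
    HK Θ →* (Function.End (Fin n → α))ᵐᵒᵖ :=
  PresentedMonoid.lift (M := (Function.End (Fin n → α))ᵐᵒᵖ)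
    (fun i => MulOpposite.op fun v => Function.update v i (F v i)) <| by
    have key : ∀ v i j a, ¬ Θ.Adj j i → F (Function.update v j a) i = F v i := by
      intro v i j a h
      refine hF _ _ _ fun k hk => Function.update_of_ne ?_ _ _
      rintro rfl
      exact h hk
    rintro _ _ (i | ⟨i, j, h⟩ | ⟨i, j, h⟩ | ⟨i, j, h⟩) <;>
      simp only [map_mul, FreeMonoid.lift_eval_of] <;>
      refine MulOpposite.unop_injective (funext fun v => ?_)
    · change Function.update (Function.update v i _) i (F (Function.update v i _) i) = _
      rw [key _ _ _ _ (hΘ.no_loop i), Function.update_idem]; rfl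
    · change Function.update (Function.update v i _) j (F (Function.update v i _) j) =
        Function.update (Function.update v j _) i (F (Function.update v j _) i)
      rw [key _ _ _ _ h.2.1, key _ _ _ _ h.2.2, Function.update_comm h.1]
    · have hji := hΘ.no_two_cycle i j h
      have hne : i ≠ j := fun e => hΘ.no_loop j (e ▸ h)
      change Function.update (Function.update (Function.update v i _) j _) i
        (F (Function.update (Function.update v i _) j _) i) =
        Function.update (Function.update v i _) j (F (Function.update v i _) j)
      rw [key _ _ _ _ hji, key _ _ _ _ (hΘ.no_loop i), Function.update_comm hne.symm,
        Function.update_idem]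
      rfl
    · have hji := hΘ.no_two_cycle i j h
      have hne : i ≠ j := fun e => hΘ.no_loop j (e ▸ h)
      change Function.update (Function.update (Function.update v j (F v j)) i
        (F (Function.update v j (F v j)) i)) j
        (F (Function.update (Function.update v j (F v j)) i
        (F (Function.update v j (F v j)) i)) j) =
        Function.update (Function.update v i (F v i)) j (F (Function.update v i (F v i)) j)
      rw [key _ _ _ _ hji, Function.update_comm hne.symm, key _ _ _ _ (hΘ.no_loop j),
        Function.update_idem]

section UpdateAction

variable {α : Type*} (hΘ : IsSimpleOriented Θ) (F : (Fin n → α) → Fin n → α)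
    (hF : ∀ v w i, (∀ j, Θ.Adj j i → v j = w j) → F v i = F w i)

theorem updateAction_gen (i : Fin n) (v : Fin n → α) :
    (updateAction hΘ F hF (gen Θ i)).unop v = Function.update v i (F v i) := rfl

theorem updateAction_mul (x y : HK Θ) (v : Fin n → α) :
    (updateAction hΘ F hF (x * y)).unop v =
      (updateAction hΘ F hF y).unop ((updateAction hΘ F hF x).unop v) := by
  rw [map_mul]; rfl

theorem updateAction_of_notMem_content {x : HK Θ} {i : Fin n} (hi : i ∉ content x)
    (v : Fin n → α) : (updateAction hΘ F hF x).unop v i = v i := by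
  induction x using gen_mul_induction generalizing v with
  | one => rw [map_one]; rfl
  | gen_mul a m ih =>
    rw [content_mul, content_gen, Finset.mem_union, Finset.mem_singleton, not_or] at hi
    rw [updateAction_mul, ih hi.2, updateAction_gen, Function.update_of_ne hi.1]

end UpdateAction

/-! ### Idempotents -/

/-- If every coordinate is at most its new value, the action only increases coordinates and
preserves this property; a fixed vector is then fixed by each letter. -/
theorem updateAction_monotone_orbit (hΘ : IsSimpleOriented Θ)
    (F : (Fin n → ℕ) → Fin n → ℕ) (hmono : Monotone F)
    (hF : ∀ v w i, (∀ j, Θ.Adj j i → v j = w j) → F v i = F w i) (x : HK Θ)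
    (v : Fin n → ℕ) (hv : v ≤ F v) :
    v ≤ (updateAction hΘ F hF x).unop v ∧
      (updateAction hΘ F hF x).unop v ≤ F ((updateAction hΘ F hF x).unop v) ∧
      ((updateAction hΘ F hF x).unop v = v → ∀ i ∈ content x, v i = F v i) := by
  induction x using gen_mul_induction generalizing v with
  | one =>
    rw [map_one]
    exact ⟨le_rfl, hv, fun _ i hi => by simp [content_one] at hi⟩
  | gen_mul a m ih =>
    have h1 : v ≤ Function.update v a (F v a) := le_update_iff.2 ⟨hv a, fun _ _ => le_rfl⟩
    have h2 : Function.update v a (F v a) ≤ F (Function.update v a (F v a)) :=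
      update_le_iff.2
        ⟨hmono h1 a, fun j _ => (hv j).trans (hmono h1 j)⟩
    obtain ⟨h3, h4, h5⟩ := ih _ h2
    rw [updateAction_mul, updateAction_gen]
    refine ⟨h1.trans h3, h4, fun h i hi => ?_⟩
    rw [h] at h3
    have h6 := le_antisymm h3 h1
    rw [h6] at h h5
    rw [content_mul, content_gen, Finset.mem_union, Finset.mem_singleton] at hi
    rcases hi with rfl | hi
    · simpa using (congrFun h6 i).symm
    · exact h5 h i hi

open Classical in
/-- The action `v i := sup_{j → i} (v j + 1)` on `ℕ^n`, started at zero, measures lengths of walks: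
after an idempotent it is stationary, and so bounds the walks in its content. -/
theorem content_mem_acyclicSets_of_mul_self (hΘ : IsSimpleOriented Θ) {e : HK Θ}
    (he : e * e = e) : content e ∈ acyclicSets Θ := by
  let F : (Fin n → ℕ) → Fin n → ℕ := fun v i =>
    (Finset.univ.filter fun j => Θ.Adj j i).sup fun j => v j + 1
  have hmono : Monotone F := fun v w h i =>
    Finset.sup_mono_fun fun j _ => Nat.succ_le_succ (h j)
  have hF : ∀ v w i, (∀ j, Θ.Adj j i → v j = w j) → F v i = F w i := fun v w i h =>
    Finset.sup_congr rfl fun j hj => by rw [h j (Finset.mem_filter.1 hj).2]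
  have h0 : (0 : Fin n → ℕ) ≤ F 0 := fun i => Nat.zero_le _
  set v := (updateAction hΘ F hF e).unop 0 with hv
  have hfix : (updateAction hΘ F hF e).unop v = v := by rw [hv, ← updateAction_mul, he]
  have hstat := (updateAction_monotone_orbit hΘ F hmono hF e v
    (updateAction_monotone_orbit hΘ F hmono hF e 0 h0).2.1).2.2 hfix
  intro c hc
  have hlt : ∀ i j, Relation.TransGen
      (fun i j => i ∈ content e ∧ j ∈ content e ∧ Θ.Adj i j) i j → v i < v j := by
    intro i j hij
    refine Relation.TransGen.trans_induction_on (motive := fun {i j} _ => v i < v j) hij ?_ ?_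
    · intro i j h
      rw [hstat j h.2.1]
      exact Finset.le_sup (f := fun j => v j + 1) (Finset.mem_filter.2 ⟨Finset.mem_univ i, h.2.2⟩)
    · intro i j k _ _ h h'
      exact h.trans h'
  exact lt_irrefl _ (hlt c c hc)

/-- If letters of `T` are absorbed by `e`, and `T` is closed under arrows inside `X`, these letters
can be deleted from a word in `X` standing in front of `e`. -/
theorem exists_content_sdiff_mul_eq (hΘ : IsSimpleOriented Θ) {X T : Finset (Fin n)} {e : HK Θ}
    (hT : ∀ i ∈ T, ∀ j ∈ X, Θ.Adj i j → j ∈ T) (he : ∀ i ∈ T, gen Θ i * e = e) (m : HK Θ)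
    (hm : content m ⊆ X) : ∃ m' : HK Θ, content m' = content m \ T ∧ m * e = m' * e := by
  induction m using gen_mul_induction with
  | one => exact ⟨1, by simp [content_one], rfl⟩
  | gen_mul a m ih =>
    rw [content_mul, content_gen, Finset.union_subset_iff, Finset.singleton_subset_iff] at hm
    obtain ⟨m', hm', heq⟩ := ih hm.2
    rw [content_mul, content_gen, Finset.union_sdiff_distrib]
    by_cases ha : a ∈ T
    · refine ⟨m', by simp [hm', ha], ?_⟩
      have key : gen Θ a * (m' * gen Θ a) = m' * gen Θ a := by
        apply gen_mul_eq_of_mem_content <;>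
          simp only [content_mul, content_gen, Finset.mem_union, Finset.mem_singleton, or_true,
            hm', Finset.mem_sdiff]
        rintro j (hj | rfl) hadj
        · exact hj.2 (hT a ha j (hm.2 hj.1) hadj)
        · exact hΘ.no_loop j hadj
      rw [mul_assoc, heq]
      conv_lhs => rw [← he a ha]
      rw [← mul_assoc m', ← mul_assoc, key, mul_assoc, he a ha]
    · exact ⟨gen Θ a * m', by
        rw [content_mul, content_gen, hm', Finset.sdiff_eq_self_of_disjoint
          (Finset.disjoint_singleton_left.2 ha)], by
        rw [mul_assoc, heq, mul_assoc]⟩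

open Classical in
/-- An idempotent absorbs the letters of its content on the left. For a letter `t`, the letters that
can be reached from `t` may be assumed absorbed by well-founded induction; deleting them from the
first factor of `e * e` leaves a word without arrows from `t`. -/
theorem gen_mul_eq_of_mul_self (hΘ : IsSimpleOriented Θ) {e : HK Θ} (he : e * e = e) :
    ∀ t ∈ content e, gen Θ t * e = e := by
  have hac := content_mem_acyclicSets_of_mul_self hΘ he
  set X := content e with hX
  have hwf : WellFounded (Function.swap
      (Relation.TransGen fun i j => i ∈ X ∧ j ∈ X ∧ Θ.Adj i j)) :=
    haveI : Std.Irrefl (Function.swap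
      (Relation.TransGen fun i j => i ∈ X ∧ j ∈ X ∧ Θ.Adj i j)) := ⟨hac⟩
    haveI : IsTrans _ (Function.swap
      (Relation.TransGen fun i j => i ∈ X ∧ j ∈ X ∧ Θ.Adj i j)) := ⟨fun _ _ _ h h' => h'.trans h⟩
    Finite.wellFounded_of_trans_of_irrefl _
  intro t
  induction t using hwf.induction with
  | _ t ih =>
  intro ht
  -- `T` consists of the vertices that can be reached from `t` inside `X`.
  let T : Finset (Fin n) := X.filter
    fun u => Relation.TransGen (fun i j => i ∈ X ∧ j ∈ X ∧ Θ.Adj i j) t u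
  obtain ⟨m, hm, hme⟩ := exists_content_sdiff_mul_eq hΘ (X := X) (T := T) (e := e)
    (fun i hi j hj hij => Finset.mem_filter.2 ⟨hj,
      (Finset.mem_filter.1 hi).2.tail ⟨(Finset.mem_filter.1 hi).1, hj, hij⟩⟩)
    (fun i hi => ih i (Finset.mem_filter.1 hi).2 (Finset.mem_filter.1 hi).1) e hX.ge
  have key : gen Θ t * m = m := by
    refine gen_mul_eq_of_mem_content ?_ ?_
    · rw [hm]
      exact Finset.mem_sdiff.2 ⟨ht, fun h => hac t (Finset.mem_filter.1 h).2⟩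
    · intro j hj hadj
      rw [hm] at hj
      have hj := Finset.mem_sdiff.1 hj
      exact hj.2 (Finset.mem_filter.2 ⟨hj.1, .single ⟨ht, hj.1, hadj⟩⟩)
  rw [he] at hme
  rw [hme, ← mul_assoc, key]

/-- An idempotent is the zero of the submonoid generated by the letters of its content. In
particular it is determined by its content. -/
theorem isZeroOn_content_of_mul_self (hΘ : IsSimpleOriented Θ) {e : HK Θ} (he : e * e = e) :
    IsZeroOn (content e) e := by
  obtain ⟨z, hz⟩ := exists_isZeroOn hΘ (content_mem_acyclicSets_of_mul_self hΘ he)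
  have h : z * e = e :=
    mul_eq_right_of_content_subset (gen_mul_eq_of_mul_self hΘ he) hz.content_eq.subset
  rwa [← h, mul_eq_left_of_content_subset hz.mul_gen subset_rfl, hz.content_eq]

/-! ### The braid relation between idempotents -/

/-- Membership in a set closed under arrows into `X` propagates along a walk in `X`. -/
theorem of_isChain_of_closed {X : Finset (Fin n)} {S : Fin n → Prop}
    (hS : ∀ c, S c → ∀ j ∈ X, Θ.Adj c j → S j) {l : List (Fin n)} {a b : Fin n} (hb : S b)
    (hl : ∀ i ∈ l, i ∈ X) (ha : a ∈ X) (h : List.IsChain Θ.Adj (b :: (l ++ [a]))) : S a := by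
  induction l generalizing b with
  | nil =>
    rw [List.nil_append, List.isChain_pair] at h
    exact hS b hb a ha h
  | cons c l ih =>
    rw [List.cons_append, List.isChain_cons_cons] at h
    exact ih (hS b hb c (hl c List.mem_cons_self) h.1)
      (fun i hi => hl i (List.mem_cons_of_mem c hi)) h.2

/-- The action `v i := ∃ j → i, v j` detects the walks excluded by `p(X, Y)`: started at the
indicator of `b`, it reaches `a` under `xy`, but it becomes zero under `x_b`. -/
theorem P_of_mul_mul_eq (hΘ : IsSimpleOriented Θ) {X Y : Finset (Fin n)} {x y : HK Θ}
    (hx : IsZeroOn X x) (hy : IsZeroOn Y y) (h : y * x * y = x * y) : P Θ X Y := by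
  rintro ⟨b, hb, a, ha, l, hl, hchain⟩
  rw [Finset.mem_sdiff] at hb ha
  let F : (Fin n → Prop) → Fin n → Prop := fun v i => ∃ j, Θ.Adj j i ∧ v j
  have hF : ∀ v w i, (∀ j, Θ.Adj j i → v j = w j) → F v i = F w i := fun v w i h =>
    propext (exists_congr fun j => and_congr_right fun hj => by rw [h j hj])
  have hbxy : gen Θ b * (x * y) = x * y := by
    rw [← h, ← mul_assoc, ← mul_assoc, hy.gen_mul b hb.1]
  have hxclosed : ∀ v : Fin n → Prop, ∀ c, (updateAction hΘ F hF x).unop v c →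
      ∀ j ∈ X, Θ.Adj c j → (updateAction hΘ F hF x).unop v j := by
    intro v c hc j hj hcj
    -- Since `x = x * x_j`, the `j`-th coordinate is up to date after `x` has acted.
    rw [← hx.mul_gen j hj, updateAction_mul, updateAction_gen, Function.update_self]
    exact ⟨c, hcj, hc⟩
  let v₀ : Fin n → Prop := fun i => i = b
  have hv₀ : Function.update v₀ b (F v₀ b) = fun _ => False := by
    funext i
    by_cases hi : i = b
    · subst hi
      rw [Function.update_self]
      exact eq_false fun ⟨j, hj, hji⟩ => hΘ.no_loop i (by rwa [show j = i from hji] at hj)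
    · rw [Function.update_of_ne hi]
      exact eq_false hi
  have hfalse : ∀ m : HK Θ, (updateAction hΘ F hF m).unop (fun _ => False) = fun _ => False := by
    intro m
    induction m using gen_mul_induction with
    | one => rw [map_one]; rfl
    | gen_mul c m ih =>
      rw [updateAction_mul, updateAction_gen, show F (fun _ => False) c = False by simp [F],
        show Function.update (fun _ : Fin n => False) c False = fun _ => False from
          Function.update_eq_self c _, ih]
  have h1 : ¬ (updateAction hΘ F hF (x * y)).unop v₀ a := by
    rw [← hbxy, updateAction_mul, updateAction_gen, hv₀, hfalse]
    exact id
  rw [updateAction_mul, updateAction_of_notMem_content hΘ F hF (hy.content_eq ▸ ha.2)] at h1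
  refine h1 (of_isChain_of_closed (hxclosed v₀) ?_
    (fun i hi => (Finset.mem_inter.1 (hl i hi)).1) ha.1 hchain)
  rw [updateAction_of_notMem_content hΘ F hF (hx.content_eq ▸ hb.2)]

open Classical in
/-- The part of `X ∩ Y` that can be reached from `Y \ X`: under `p(X, Y)`, no arrow into `X` leaves
it or `Y \ X`. -/
theorem P.exists_closed {X Y : Finset (Fin n)} (h : P Θ X Y) :
    ∃ R ⊆ X ∩ Y, ∀ c, c ∈ Y \ X ∨ c ∈ R → ∀ j ∈ X, Θ.Adj c j → j ∈ R := by
  refine ⟨(X ∩ Y).filter fun i => ∃ b ∈ Y \ X, ∃ l : List (Fin n),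
    (∀ k ∈ l, k ∈ X ∩ Y) ∧ List.IsChain Θ.Adj (b :: (l ++ [i])), Finset.filter_subset _ _, ?_⟩
  intro c hc j hj hcj
  have hwalk : ∃ b ∈ Y \ X, ∃ l : List (Fin n),
      (∀ k ∈ l, k ∈ X ∩ Y) ∧ List.IsChain Θ.Adj (b :: (l ++ [j])) := by
    rcases hc with hc | hc
    · exact ⟨c, hc, [], by simp, by simpa using hcj⟩
    · obtain ⟨hcXY, b, hb, l, hl, hch⟩ := Finset.mem_filter.1 hc
      refine ⟨b, hb, l ++ [c], ?_, ?_⟩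
      · intro k hk
        rcases List.mem_append.1 hk with hk | hk
        · exact hl k hk
        · rwa [List.mem_singleton.1 hk]
      · rw [← List.cons_append, List.isChain_append]
        refine ⟨hch, List.isChain_singleton j, ?_⟩
        simpa [List.getLast?_cons, List.getLast?_append] using hcj
  obtain ⟨b, hb, l, hl, hch⟩ := hwalk
  have hjY : j ∈ Y := by
    by_contra hjY
    exact h ⟨b, hb, j, Finset.mem_sdiff.2 ⟨hj, hjY⟩, l, hl, hch⟩
  exact Finset.mem_filter.2 ⟨Finset.mem_inter.2 ⟨hj, hjY⟩, b, hb, l, hl, hch⟩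

/-- Under `p(X, Y)` the product of the zeros of `X` and `Y` is the zero of `X ∪ Y`. The zero of `X`
splits as `z_{X \ R} z_R`, where `R ⊆ X ∩ Y` is the part reached from `Y \ X`; here `z_R` is
absorbed by the zero of `Y`, and letters of `Y \ X` move past `z_{X \ R}`. -/
theorem IsZeroOn.mul_of_P (hΘ : IsSimpleOriented Θ) {X Y : Finset (Fin n)} {x y : HK Θ}
    (hx : IsZeroOn X x) (hy : IsZeroOn Y y) (h : P Θ X Y) : IsZeroOn (X ∪ Y) (x * y) := by
  obtain ⟨R, hR, hcl⟩ := h.exists_closed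
  have hRX : R ⊆ X := hR.trans Finset.inter_subset_left
  have hX : X ∈ acyclicSets Θ :=
    hx.content_eq ▸ content_mem_acyclicSets_of_mul_self hΘ hx.mul_self
  obtain ⟨u, hu⟩ := exists_isZeroOn hΘ (acyclicSets_mono (Finset.sdiff_subset (t := R)) hX)
  obtain ⟨r, hr⟩ := exists_isZeroOn hΘ (acyclicSets_mono hRX hX)
  have hur := hu.mul hΘ hr fun i hi j hj hij =>
    (Finset.mem_sdiff.1 hj).2 (hcl i (Or.inr hi) j (Finset.mem_sdiff.1 hj).1 hij)
  rw [Finset.sdiff_union_of_subset hRX] at hur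
  have hry : r * y = y := mul_eq_right_of_content_subset hy.gen_mul
    (hr.content_eq.subset.trans (hR.trans Finset.inter_subset_right))
  have hxy : x * y = u * y := by rw [hx.unique hur, mul_assoc, hry]
  have hcont : content (x * y) = X ∪ Y := by rw [content_mul, hx.content_eq, hy.content_eq]
  -- Left absorption makes `x * y` idempotent, hence a two-sided zero on its content.
  have habs : ∀ i ∈ X ∪ Y, gen Θ i * (x * y) = x * y := by
    intro i hi
    by_cases hiX : i ∈ X
    · rw [← mul_assoc, hx.gen_mul i hiX]
    · have hiY : i ∈ Y := (Finset.mem_union.1 hi).resolve_left hiX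
      have key : gen Θ i * (u * gen Θ i) = u * gen Θ i := by
        apply gen_mul_eq_of_mem_content <;>
          simp only [content_mul, content_gen, Finset.mem_union, Finset.mem_singleton, or_true,
            hu.content_eq, Finset.mem_sdiff]
        rintro j (hj | rfl) hadj
        · exact hj.2 (hcl i (Or.inl (Finset.mem_sdiff.2 ⟨hiY, hiX⟩)) j hj.1 hadj)
        · exact hΘ.no_loop j hadj
      rw [hxy, ← hy.gen_mul i hiY, ← mul_assoc u, ← mul_assoc, key]
  have hidem : x * y * (x * y) = x * y :=
    mul_eq_right_of_content_subset habs hcont.subset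
  exact hcont ▸ isZeroOn_content_of_mul_self hΘ hidem

theorem IsZeroOn.braid_of_P (hΘ : IsSimpleOriented Θ) {X Y : Finset (Fin n)} {x y : HK Θ}
    (hx : IsZeroOn X x) (hy : IsZeroOn Y y) (h : P Θ X Y) :
    x * y * x = x * y ∧ y * x * y = x * y := by
  have hz := hx.mul_of_P hΘ hy h
  refine ⟨mul_eq_left_of_content_subset hz.mul_gen ?_, ?_⟩
  · exact hx.content_eq.subset.trans Finset.subset_union_left
  · rw [mul_assoc]
    exact mul_eq_right_of_content_subset hz.gen_mul
      (hy.content_eq.subset.trans Finset.subset_union_right)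

/-! ### Endomorphisms -/

theorem content_end_apply (ψ : Monoid.End (HK Θ)) (m : HK Θ) :
    content (ψ m) = (content m).biUnion fun j => content (ψ (gen Θ j)) := by
  induction m using gen_mul_induction with
  | one => rw [map_one]; rfl
  | gen_mul a m ih =>
    rw [map_mul, content_mul, content_mul, ih, content_gen, Finset.union_biUnion,
      Finset.singleton_biUnion]

/-- The homomorphism from `End(HK_Θ)` to `S_n` given by `φ ↦ (c(φ(x_1)), …, c(φ(x_n)))`. -/
def contentSeq (Θ : Digraph (Fin n)) : Monoid.End (HK Θ) →* SetSeq n where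
  toFun φ := ⟨fun i => content (φ (gen Θ i))⟩
  map_one' := SetSeq.ext (funext fun i => content_gen (Θ := Θ) i)
  map_mul' ψ φ := SetSeq.ext (funext fun i => content_end_apply ψ (φ (gen Θ i)))

theorem end_gen_mul_self (φ : Monoid.End (HK Θ)) (i : Fin n) :
    φ (gen Θ i) * φ (gen Θ i) = φ (gen Θ i) := by
  rw [← map_mul, gen_mul_self]

theorem isZeroOn_end_gen (hΘ : IsSimpleOriented Θ) (φ : Monoid.End (HK Θ)) (i : Fin n) :
    IsZeroOn ((contentSeq Θ φ).sets i) (φ (gen Θ i)) :=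
  isZeroOn_content_of_mul_self hΘ (end_gen_mul_self φ i)

theorem contentSeq_injective (hΘ : IsSimpleOriented Θ) : Function.Injective (contentSeq Θ) := by
  intro φ ψ h
  refine PresentedMonoid.ext (Rel Θ) fun i => ?_
  change φ (gen Θ i) = ψ (gen Θ i)
  have hφ := isZeroOn_end_gen hΘ φ i
  rw [h] at hφ
  exact hφ.unique (isZeroOn_end_gen hΘ ψ i)

theorem isPure_contentSeq (hΘ : IsSimpleOriented Θ) (φ : Monoid.End (HK Θ)) :
    IsPure Θ (contentSeq Θ φ) where
  acyclic i := content_mem_acyclicSets_of_mul_self hΘ (end_gen_mul_self φ i)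
  disconnected i j h := by
    have hcomm := gen_comm h
    refine ⟨P_of_mul_mul_eq hΘ (isZeroOn_end_gen hΘ φ i) (isZeroOn_end_gen hΘ φ j) ?_,
      P_of_mul_mul_eq hΘ (isZeroOn_end_gen hΘ φ j) (isZeroOn_end_gen hΘ φ i) ?_⟩ <;>
    simp only [← map_mul]
    · rw [← hcomm, mul_assoc, gen_mul_self]
    · rw [hcomm, mul_assoc, gen_mul_self]
  arrow i j h := P_of_mul_mul_eq hΘ (isZeroOn_end_gen hΘ φ i) (isZeroOn_end_gen hΘ φ j) <| by
    rw [← map_mul, ← map_mul, ← map_mul, gen_braid_right h]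

theorem IsPure.exists_contentSeq_eq (hΘ : IsSimpleOriented Θ) {X : SetSeq n} (hX : IsPure Θ X) :
    ∃ φ, contentSeq Θ φ = X := by
  choose z hz using fun i => exists_isZeroOn hΘ (hX.acyclic i)
  refine ⟨PresentedMonoid.lift z ?_, SetSeq.ext (funext fun i => (hz i).content_eq)⟩
  rintro _ _ (i | ⟨i, j, h⟩ | ⟨i, j, h⟩ | ⟨i, j, h⟩) <;>
    simp only [map_mul, FreeMonoid.lift_eval_of]
  · exact (hz i).mul_self
  · have hP := hX.disconnected i j h
    exact ((hz i).braid_of_P hΘ (hz j) hP.1).2.symm.trans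
      ((hz j).braid_of_P hΘ (hz i) hP.2).1
  · exact ((hz i).braid_of_P hΘ (hz j) (hX.arrow i j h)).1
  · exact ((hz i).braid_of_P hΘ (hz j) (hX.arrow i j h)).2

/-! ### Boolean matrices -/

theorem Psi_entry (X : SetSeq n) (x i : Fin n) : (Psi X).entry x i = true ↔ x ∈ X.sets i :=
  decide_eq_true_iff

/-- `Psi` as a homomorphism of monoids. -/
def psiHom (n : ℕ) : SetSeq n →* BoolMatrix n where
  toFun := Psi
  map_one' := by
    ext x i
    rw [Bool.eq_iff_iff, Psi_entry, BoolMatrix.one_entry, SetSeq.one_sets, Finset.mem_singleton]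
  map_mul' X Y := by
    ext x i
    rw [Bool.eq_iff_iff]
    simp only [Psi_entry, BoolMatrix.mul_entry, SetSeq.mul_sets, Finset.mem_biUnion, and_comm]

theorem psiHom_injective : Function.Injective (psiHom n) := by
  intro X Y h
  ext i x
  rw [← Psi_entry, ← Psi_entry]
  exact Iff.of_eq (congrArg (fun A : BoolMatrix n => A.entry x i = true) h)

end HeckeKiselman

open HeckeKiselman in
theorem mainTheorem1 (n : ℕ) (Θ : Digraph (Fin n)) (hΘ : IsSimpleOriented Θ) :
    ∃ S : Submonoid (SetSeq n), (S : Set (SetSeq n)) = pureSeqs Θ ∧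
      (∃ F : Monoid.End (HK Θ) ≃* S,
        ∀ (φ : Monoid.End (HK Θ)) (i : Fin n),
          (F φ : SetSeq n).sets i = content (φ (gen Θ i))) ∧
      ∃ B : Submonoid (BoolMatrix n), (B : Set (BoolMatrix n)) = Psi '' pureSeqs Θ ∧
        ∃ G : S ≃* B, ∀ X : S, (G X : BoolMatrix n) = Psi (X : SetSeq n) := by
  have hS : (MonoidHom.mrange (contentSeq Θ) : Set (SetSeq n)) = pureSeqs Θ := by
    ext X
    constructor
    · rintro ⟨φ, rfl⟩
      exact isPure_contentSeq hΘ φ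
    · exact fun hX => IsPure.exists_contentSeq_eq hΘ hX
  refine ⟨MonoidHom.mrange (contentSeq Θ), hS, ⟨MulEquiv.ofBijective (MonoidHom.mrangeRestrict (contentSeq Θ))
    ⟨fun φ ψ h => contentSeq_injective hΘ (congrArg Subtype.val h),
      MonoidHom.mrangeRestrict_surjective _⟩, fun φ i => rfl⟩,
    (MonoidHom.mrange (contentSeq Θ)).map (psiHom n), ?_,
    (MonoidHom.mrange (contentSeq Θ)).equivMapOfInjective (psiHom n) psiHom_injective, fun X => rfl⟩
  rw [Submonoid.coe_map, hS]
  rfl
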